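/- Let $D\subset\mathbb R^2$ be a bounded domain (a nonempty, bounded, connected open set) such that for every continuous $g:\partial D\to\mathbb R$ the Dirichlet problem has a solution $u_g\in C^2(D)\cap C(\overline D)$, i.e. $\Delta u_g=0$ in $D$ and $u_g=g$ on $\partial D$ (this solution is then unique). For $x\in D$ define $I_x:C(\partial D)\to\mathbb R$ by $I_x(g)=u_g(x)$. Let $T_1$ be the set of all $\varphi:\partial D\to[-\infty,\infty]$ that are pointwise limits of a pointwise increasing sequence $(g_n)$ in $C(\partial D)$, and for such $\varphi$ put $I_{1,x}(\varphi)=\lim_{n\to\infty} I_x(g_n)\in(-\infty,\infty]$ (this does not depend on the choice of the sequence). For an arbitrary $f:\partial D\to[-\infty,\infty]$ put $$\overline I_x(f)=\inf\{I_{1,x}(\varphi):\varphi\in T_1,\ f\le\varphi\},\qquad \underline I_x(f)=-\overline I_x(-f),$$ where $\inf\emptyset=+\infty$. Let $\mathcal L_x$ be the class of all $f$ with $-\infty<\underline I_x(f)=\overline I_x(f)<\infty$ (the Daniell integrable functions for $I_x$), and for $f\in\mathcal L_x$ denote this common value by $\int_x f$. If $x\in D$ and $f\in\mathcal L_x$,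 then $f\in\mathcal L_y$ for every $y\in D$. Moreover, the function $v_f:D\to\mathbb R$, $v_f(y)=\int_y f$, is harmonic in $D$, i.e. it is of class $C^2$ and $\Delta v_f=0$ in $D$. -/

import Mathlib

open Filter Topology

/-! ### The Daniell extension of a functional on the continuous real functions -/

namespace Daniell

variable {X : Type*} [TopologicalSpace X]

/-- The sequence `g` of continuous real functions increases pointwise to the extended real
valued function `φ`. -/
def IncreasesTo (g : ℕ → C(X, ℝ)) (φ : X → EReal) : Prop :=
  Monotone g ∧ ∀ t, Tendsto (fun n => ((g n t : ℝ) : EReal)) atTop (𝓝 (φ t))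

variable (X) in
/-- The class `T₁` of pointwise limits of increasing sequences of continuous real functions. -/
def T₁ : Set (X → EReal) :=
  {φ | ∃ g : ℕ → C(X, ℝ), IncreasesTo g φ}

/-- The extension `I₁` of a functional `I` to `T₁`: the limit of `I (g n)` along a sequence `g`
of continuous functions that increases to `φ`. For a positive linear `I` with the monotone
continuity property of an integral the limit exists in `(-∞, ∞]` and does not depend on the
sequence `g`. -/
noncomputable def I₁ (I : C(X, ℝ) → ℝ) (φ : T₁ X) : EReal :=
  limUnder atTop (fun n => ((I (Classical.choose φ.2 n) : ℝ) : EReal))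

/-- The upper integral, `inf {I₁ φ : f ≤ φ, φ ∈ T₁}` (which is `⊤` if there is no such `φ`). -/
noncomputable def upperIntegral (I : C(X, ℝ) → ℝ) (f : X → EReal) : EReal :=
  sInf {c | ∃ φ : T₁ X, f ≤ φ.1 ∧ c = I₁ I φ}

/-- The lower integral. -/
noncomputable def lowerIntegral (I : C(X, ℝ) → ℝ) (f : X → EReal) : EReal :=
  -upperIntegral I (-f)

/-- The class `𝓛` of functions that are Daniell integrable for `I`: upper and lower integral
agree and are finite. -/
def Integrable (I : C(X, ℝ) → ℝ) (f : X → EReal) : Prop :=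
  ⊥ < lowerIntegral I f ∧ lowerIntegral I f = upperIntegral I f ∧ upperIntegral I f < ⊤

/-- The Daniell integral, the common value of upper and lower integral (meaningful for
integrable `f`). -/
noncomputable def integral (I : C(X, ℝ) → ℝ) (f : X → EReal) : ℝ :=
  (upperIntegral I f).toReal

end Daniell

/-! ### The Dirichlet problem in the plane -/

namespace Dirichlet

/-- `u` solves the classical Dirichlet problem on `D` with boundary values `g`: it is `C²` with
`Δ u = 0` on the open set `D`, continuous on the closure of `D`, and equal to `g` on `∂D`.
Only the values of `u` on the closure of `D` matter. -/
structure IsSolution (D : Set (EuclideanSpace ℝ (Fin 2))) (g : C(frontier D, ℝ))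
    (u : EuclideanSpace ℝ (Fin 2) → ℝ) : Prop where
  harmonic : InnerProductSpace.HarmonicOnNhd u D
  continuousOn : ContinuousOn u (closure D)
  boundary : ∀ z : frontier D, u z = g z

/-- The classical Dirichlet problem on `D` is solvable for all continuous boundary values. -/
def Solvable (D : Set (EuclideanSpace ℝ (Fin 2))) : Prop :=
  ∀ g : C(frontier D, ℝ), ∃ u, IsSolution D g u

variable {D : Set (EuclideanSpace ℝ (Fin 2))}

/-- The solution `u_g` (unique on the closure of `D` if `D` is a bounded domain). -/
noncomputable def solution (hD : Solvable D) (g : C(frontier D, ℝ)) :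
    EuclideanSpace ℝ (Fin 2) → ℝ :=
  Classical.choose (hD g)

/-- The functional `I_x (g) = u_g (x)`, used for `x ∈ D`. -/
noncomputable def functional (hD : Solvable D) (x : EuclideanSpace ℝ (Fin 2)) :
    C(frontier D, ℝ) → ℝ :=
  fun g => solution hD g x

/-- The function `v_f (y) = ∫_y f`, used for `y ∈ D`. -/
noncomputable def generalizedSolution (hD : Solvable D) (f : frontier D → EReal) :
    EuclideanSpace ℝ (Fin 2) → ℝ :=
  fun y => Daniell.integral (functional hD y) f

end Dirichlet

/-!
Let `I_x g = u_g x`. The theorem combines a domination property of these functionals, which comes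
from Harnack's inequality, with a one-functional approximation property of Daniell integrable
functions.

On a connected open set the nonnegative harmonic functions are bounded near any point `y` by a
fixed multiple of their value at `x` (`exists_harnack_const`). A first consequence is the minimum
principle, hence uniqueness for the Dirichlet problem, so that every `I_x` is a positive linear
functional (`isPositiveLinear_functional`). A second one is that `I_z ≤ C • I_x` on nonnegative
functions, with one constant `C` for all `z` near `y` (`exists_functional_le`).

Let `f` be integrable for `I_x`. Squeeze `f` between `-ψ` and `φ` in the sense of `T₁`, where
`I₁ φ + I₁ ψ` is small, and let continuous `g n ↑ φ` and `h n ↑ ψ`. Dini's theorem gives an `N` for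
which `I_x (g N + h N)` is almost nonnegative, and then `I_x` changes little when `N` is replaced by
a larger index. Domination carries all these estimates to `I_z`, so the upper and the lower
integral of `f` for `I_z` are both within `C * ε` of `I_z (g N)`, with `g N` independent of `z`
(`Integrable.exists_continuous_approx`). Hence `f` is integrable for `I_z`, and
`z ↦ ∫_z f` is locally a uniform limit of the harmonic functions `u_{g N}`. Such a limit is
harmonic by the Poisson formula (`harmonicAt_of_uniform_approx`).
-/

/-! ### Positive linear functionals and the Daniell extension -/

namespace Daniell

variable {X : Type*} [TopologicalSpace X]

/-- A linear functional on the continuous functions that is nonnegative on nonnegative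
functions. On a compact space such a functional automatically has the monotone continuity
property of an integral, by Dini's theorem. -/
structure IsPositiveLinear (I : C(X, ℝ) → ℝ) : Prop where
  map_add : ∀ g h, I (g + h) = I g + I h
  map_smul : ∀ (c : ℝ) g, I (c • g) = c * I g
  nonneg : ∀ g, 0 ≤ g → 0 ≤ I g

namespace IsPositiveLinear

variable {I : C(X, ℝ) → ℝ}

theorem map_sub (hI : IsPositiveLinear I) (g h : C(X, ℝ)) : I (g - h) = I g - I h := by
  have := hI.map_add (g - h) h
  rw [sub_add_cancel] at this
  linarith

theorem monotone (hI : IsPositiveLinear I) : Monotone I := fun g h hgh => by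
  have := hI.nonneg (h - g) (sub_nonneg.2 hgh)
  rw [hI.map_sub] at this
  linarith

end IsPositiveLinear

theorem I₁_eq_iSup {I : C(X, ℝ) → ℝ} (hI : IsPositiveLinear I) (φ : T₁ X) :
    I₁ I φ = ⨆ n, ((I (Classical.choose φ.2 n) : ℝ) : EReal) :=
  (tendsto_atTop_iSup fun _ _ hmn => EReal.coe_le_coe_iff.2
    (hI.monotone ((Classical.choose_spec φ.2).1 hmn))).limUnder_eq

/-- A form of Dini's theorem: if `g n ↑ φ` and `h n ↑ ψ` with `φ + ψ ≥ 0`, then `g n + h n` is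
eventually bounded below by `-ε`, uniformly on the compact space. The hypothesis is written as
`-ψ ≤ φ` because the sum of extended real numbers need not make sense. -/
theorem IncreasesTo.exists_neg_lt_add [CompactSpace X] {g h : ℕ → C(X, ℝ)} {φ ψ : X → EReal}
    (hg : IncreasesTo g φ) (hh : IncreasesTo h ψ) (hle : -ψ ≤ φ) {ε : ℝ} (hε : 0 < ε) :
    ∃ N, ∀ t, -ε < g N t + h N t := by
  have hpt : ∀ t, ∃ n, -ε < g n t + h n t := by
    intro t
    by_contra! hcon
    -- By monotonicity the bound `g n t + h n t ≤ -ε` extends to different indices, so the two limits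
    -- may be taken one after the other; in particular both are finite.
    have h1 : ∀ n m, g n t ≤ -ε - h m t := fun n m => by
      have a : g n t ≤ g (max n m) t := hg.1 (le_max_left n m) t
      have b : h m t ≤ h (max n m) t := hh.1 (le_max_right n m) t
      have := hcon (max n m)
      linarith
    have h2 : ∀ m, φ t ≤ ((-ε - h m t : ℝ) : EReal) := fun m =>
      le_of_tendsto (hg.2 t) (Eventually.of_forall fun n => EReal.coe_le_coe_iff.2 (h1 n m))
    have h3 : ((g 0 t : ℝ) : EReal) ≤ φ t :=
      ge_of_tendsto (hg.2 t) (Eventually.of_forall fun n =>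
        EReal.coe_le_coe_iff.2 (hg.1 (Nat.zero_le n) t))
    obtain ⟨p, hp⟩ : ∃ p : ℝ, (p : EReal) = φ t := by
      refine ⟨(φ t).toReal, EReal.coe_toReal ?_ ?_⟩
      · exact ((h2 0).trans_lt (EReal.coe_lt_top _)).ne
      · exact ((EReal.bot_lt_coe _).trans_le h3).ne'
    have h4 : ψ t ≤ ((-ε - p : ℝ) : EReal) := by
      refine le_of_tendsto (hh.2 t) (Eventually.of_forall fun m => EReal.coe_le_coe_iff.2 ?_)
      have := h2 m
      rw [← hp, EReal.coe_le_coe_iff] at this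
      linarith
    have h5 : ((ε + p : ℝ) : EReal) ≤ p := by
      have a : -((-ε - p : ℝ) : EReal) ≤ -ψ t := EReal.neg_le_neg_iff.2 h4
      have b : -ψ t ≤ φ t := hle t
      rw [← EReal.coe_neg] at a
      rw [show ε + p = -(-ε - p) by ring, hp]
      exact a.trans b
    rw [EReal.coe_le_coe_iff] at h5
    linarith
  obtain ⟨N, hN⟩ := isCompact_univ.elim_directed_cover (fun n => {t : X | -ε < g n t + h n t})
    (fun n => isOpen_lt continuous_const ((g n).continuous.add (h n).continuous))
    (fun t _ => Set.mem_iUnion.2 (hpt t))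
    (Monotone.directed_le fun m n hmn t (ht : _ < _) =>
      ht.trans_le (add_le_add (hg.1 hmn t) (hh.1 hmn t)))
  exact ⟨N, fun t => hN (Set.mem_univ t)⟩

/-- Under the hypotheses of `IncreasesTo.exists_neg_lt_add`, some `g N + h N` becomes nonnegative
after adding a constant `δ` whose `I`-value is less than `ε`. The constant is kept in the statement
because a functional dominated by `I` can only be estimated on nonnegative functions. -/
theorem exists_neg_lt_map_add [CompactSpace X] {I : C(X, ℝ) → ℝ} (hI : IsPositiveLinear I)
    {g h : ℕ → C(X, ℝ)} {φ ψ : X → EReal}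
    (hg : IncreasesTo g φ) (hh : IncreasesTo h ψ) (hle : -ψ ≤ φ) {ε : ℝ} (hε : 0 < ε) :
    ∃ N, ∃ δ : ℝ, 0 ≤ g N + h N + δ • (1 : C(X, ℝ)) ∧ 0 ≤ δ ∧
      I (δ • (1 : C(X, ℝ))) < ε := by
  have h1 : 0 ≤ I 1 := hI.nonneg 1 zero_le_one
  have hδ : 0 < ε / (I 1 + 1) := by positivity
  obtain ⟨N, hN⟩ := hg.exists_neg_lt_add hh hle hδ
  refine ⟨N, ε / (I 1 + 1), fun t => ?_, hδ.le, ?_⟩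
  · have := hN t
    change 0 ≤ g N t + h N t + ε / (I 1 + 1) * 1
    linarith
  · rw [hI.map_smul, div_mul_eq_mul_div, div_lt_iff₀ (by positivity)]
    nlinarith

theorem upperIntegral_le_I₁ (I : C(X, ℝ) → ℝ) {f : X → EReal} (φ : T₁ X) (h : f ≤ φ.1) :
    upperIntegral I f ≤ I₁ I φ :=
  sInf_le ⟨φ, h, rfl⟩

theorem exists_I₁_lt {I : C(X, ℝ) → ℝ} {f : X → EReal} {c : EReal} (h : upperIntegral I f < c) :
    ∃ φ : T₁ X, f ≤ φ.1 ∧ I₁ I φ < c := by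
  obtain ⟨_, ⟨φ, hφ, rfl⟩, hlt⟩ := sInf_lt_iff.1 h
  exact ⟨φ, hφ, hlt⟩

theorem neg_I₁_le_I₁ [CompactSpace X] {I : C(X, ℝ) → ℝ} (hI : IsPositiveLinear I) {φ ψ : T₁ X}
    (hle : -ψ.1 ≤ φ.1) : -I₁ I ψ ≤ I₁ I φ := by
  by_contra! hcon
  obtain ⟨c, hc1, hc2⟩ := EReal.lt_iff_exists_real_btwn.1 hcon
  obtain ⟨d, hd1, hd2⟩ := EReal.lt_iff_exists_real_btwn.1 hc2
  have hcd : c < d := EReal.coe_lt_coe_iff.1 hd1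
  obtain ⟨N, δ, h0, -, hδ⟩ := exists_neg_lt_map_add hI (Classical.choose_spec φ.2)
    (Classical.choose_spec ψ.2) hle (sub_pos.2 hcd)
  have hg : I (Classical.choose φ.2 N) < c := by
    rw [← EReal.coe_lt_coe_iff]
    refine lt_of_le_of_lt ?_ hc1
    rw [I₁_eq_iSup hI]
    exact le_iSup (fun n => ((I (Classical.choose φ.2 n) : ℝ) : EReal)) N
  have hh : I (Classical.choose ψ.2 N) < -d := by
    rw [← EReal.coe_lt_coe_iff]
    refine lt_of_le_of_lt ?_ (EReal.lt_neg_comm.1 hd2)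
    rw [I₁_eq_iSup hI]
    exact le_iSup (fun n => ((I (Classical.choose ψ.2 n) : ℝ) : EReal)) N
  have := hI.nonneg _ h0
  rw [hI.map_add, hI.map_add] at this
  linarith

theorem lowerIntegral_le_upperIntegral [CompactSpace X] {I : C(X, ℝ) → ℝ}
    (hI : IsPositiveLinear I) (f : X → EReal) : lowerIntegral I f ≤ upperIntegral I f := by
  refine le_sInf ?_
  rintro _ ⟨φ, hφ, rfl⟩
  rw [lowerIntegral, EReal.neg_le]
  refine le_sInf ?_
  rintro _ ⟨ψ, hψ, rfl⟩
  rw [EReal.neg_le]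
  refine neg_I₁_le_I₁ hI fun t => (EReal.neg_le_neg_iff.2 (hψ t)).trans ?_
  simpa using hφ t

/-- If `f` is integrable for `I`, then a single continuous function `g` approximates `f` in the
sense of every functional `J` dominated by a multiple of `I`, with an error controlled by the
domination constant only. That `g` does not depend on `J` is what turns pointwise
approximation into locally uniform approximation for a family of functionals. -/
theorem Integrable.exists_continuous_approx [CompactSpace X] {I : C(X, ℝ) → ℝ}
    (hI : IsPositiveLinear I) {f : X → EReal} (hf : Integrable I f) {ε : ℝ} (hε : 0 < ε) :
    ∃ g : C(X, ℝ), ∀ (J : C(X, ℝ) → ℝ) (C : ℝ), IsPositiveLinear J → 0 ≤ C →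
      (∀ k, 0 ≤ k → J k ≤ C * I k) →
        upperIntegral J f ≤ ((J g + C * ε : ℝ) : EReal) ∧
        ((J g - C * ε : ℝ) : EReal) ≤ lowerIntegral J f := by
  obtain ⟨hbot, heq, htop⟩ := hf
  obtain ⟨a, ha⟩ : ∃ a : ℝ, (a : EReal) = upperIntegral I f :=
    ⟨_, EReal.coe_toReal htop.ne (heq ▸ hbot).ne'⟩
  have ha' : upperIntegral I (-f) = ((-a : ℝ) : EReal) := by
    rw [EReal.coe_neg, ha, ← heq, lowerIntegral, neg_neg]
  -- The final error is twice `C * (3 * η)`.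
  set η := ε / 6 with hη
  have hη0 : 0 < η := by positivity
  obtain ⟨φ, hφ, hφI⟩ := exists_I₁_lt (I := I) (f := f) (c := ((a + η : ℝ) : EReal))
    (by rw [← ha, EReal.coe_lt_coe_iff]; linarith)
  obtain ⟨ψ, hψ, hψI⟩ := exists_I₁_lt (I := I) (f := -f) (c := ((-a + η : ℝ) : EReal))
    (by rw [ha', EReal.coe_lt_coe_iff]; linarith)
  have hle : -ψ.1 ≤ φ.1 := fun t => by
    refine (EReal.neg_le_neg_iff.2 (hψ t)).trans ?_
    simpa using hφ t
  rw [I₁_eq_iSup hI] at hφI hψI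
  have hgm := Classical.choose_spec φ.2
  have hhm := Classical.choose_spec ψ.2
  have hJφ : ∀ J : C(X, ℝ) → ℝ, IsPositiveLinear J → I₁ J φ = _ := fun J hJ => I₁_eq_iSup hJ φ
  have hJψ : ∀ J : C(X, ℝ) → ℝ, IsPositiveLinear J → I₁ J ψ = _ := fun J hJ => I₁_eq_iSup hJ ψ
  -- The same chosen sequences compute `I₁` for all functionals, so they may now be named `g`, `h`.
  generalize Classical.choose φ.2 = g at *
  generalize Classical.choose ψ.2 = h at *
  have hg : ∀ n, I (g n) < a + η := fun n => EReal.coe_lt_coe_iff.1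
    ((le_iSup (fun n => ((I (g n) : ℝ) : EReal)) n).trans_lt hφI)
  have hh : ∀ n, I (h n) < -a + η := fun n => EReal.coe_lt_coe_iff.1
    ((le_iSup (fun n => ((I (h n) : ℝ) : EReal)) n).trans_lt hψI)
  obtain ⟨N, δ, h0, hδ0, hδ⟩ := exists_neg_lt_map_add hI hgm hhm hle hη0
  have hIN := hI.nonneg _ h0
  rw [hI.map_add, hI.map_add] at hIN
  refine ⟨g N, fun J C hJ hC hdom => ?_⟩
  -- From `N` on, `I` varies by at most `3 * η` along either sequence; by domination `J` varies
  -- by at most `C * (3 * η)`.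
  have hgJ : ∀ n, J (g n) ≤ J (g N) + C * (3 * η) := fun n => by
    have h1 := hJ.monotone (hgm.1 (le_max_left n N))
    have h2 := hdom _ (sub_nonneg.2 (hgm.1 (le_max_right n N)))
    rw [hJ.map_sub, hI.map_sub] at h2
    have h3 : I (g (max n N)) - I (g N) ≤ 3 * η := by
      linarith [hg (max n N), hh N]
    linarith [mul_le_mul_of_nonneg_left h3 hC]
  have hhJ : ∀ n, J (h n) ≤ J (h N) + C * (3 * η) := fun n => by
    have h1 := hJ.monotone (hhm.1 (le_max_left n N))
    have h2 := hdom _ (sub_nonneg.2 (hhm.1 (le_max_right n N)))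
    rw [hJ.map_sub, hI.map_sub] at h2
    have h3 : I (h (max n N)) - I (h N) ≤ 3 * η := by
      linarith [hh (max n N), hg N]
    linarith [mul_le_mul_of_nonneg_left h3 hC]
  have hsum : J (h N) ≤ -J (g N) + C * (3 * η) := by
    have h1 := hdom _ h0
    rw [hJ.map_add, hJ.map_add, hI.map_add, hI.map_add, hJ.map_smul] at h1
    have h2 : I (g N) + I (h N) + I (δ • (1 : C(X, ℝ))) ≤ 3 * η := by
      linarith [hg N, hh N]
    linarith [mul_le_mul_of_nonneg_left h2 hC, mul_nonneg hδ0 (hJ.nonneg 1 zero_le_one)]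
  have hCη : 0 ≤ C * η := mul_nonneg hC hη0.le
  have hCε : C * ε = C * (3 * η) + C * (3 * η) := by rw [hη]; ring
  constructor
  · refine (upperIntegral_le_I₁ J φ hφ).trans ?_
    rw [hJφ J hJ]
    exact iSup_le fun n => EReal.coe_le_coe_iff.2 (by linarith [hgJ n])
  · rw [lowerIntegral, EReal.le_neg, ← EReal.coe_neg]
    refine (upperIntegral_le_I₁ J ψ hψ).trans ?_
    rw [hJψ J hJ]
    exact iSup_le fun n => EReal.coe_le_coe_iff.2 (by linarith [hhJ n])

theorem Integrable.of_forall_approx [CompactSpace X] {J : C(X, ℝ) → ℝ} (hJ : IsPositiveLinear J)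
    {f : X → EReal} {C : ℝ} (hC : 0 ≤ C)
    (h : ∀ ε > 0, ∃ b : ℝ, upperIntegral J f ≤ ((b + C * ε : ℝ) : EReal) ∧
      ((b - C * ε : ℝ) : EReal) ≤ lowerIntegral J f) : Integrable J f := by
  have hle := lowerIntegral_le_upperIntegral hJ f
  obtain ⟨b, hb1, hb2⟩ := h 1 one_pos
  have hbot : ⊥ < lowerIntegral J f := (EReal.bot_lt_coe _).trans_le hb2
  have htop : upperIntegral J f < ⊤ := hb1.trans_lt (EReal.coe_lt_top _)
  refine ⟨hbot, le_antisymm hle ?_, htop⟩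
  have hl := EReal.coe_toReal (hle.trans_lt htop).ne hbot.ne'
  have hr := EReal.coe_toReal htop.ne (hbot.trans_le hle).ne'
  rw [← hl, ← hr, EReal.coe_le_coe_iff]
  refine le_of_forall_pos_le_add fun ε hε => ?_
  obtain ⟨b, h1, h2⟩ := h (ε / (2 * C + 1)) (by positivity)
  rw [← hr, EReal.coe_le_coe_iff] at h1
  rw [← hl, EReal.coe_le_coe_iff] at h2
  have h3 : 2 * (C * (ε / (2 * C + 1))) ≤ ε := by
    rw [mul_div_assoc', mul_div_assoc', div_le_iff₀ (by positivity)]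
    nlinarith
  linarith

theorem Integrable.abs_integral_sub_le {J : C(X, ℝ) → ℝ} {f : X → EReal} (hf : Integrable J f)
    {b r : ℝ} (h1 : upperIntegral J f ≤ ((b + r : ℝ) : EReal))
    (h2 : ((b - r : ℝ) : EReal) ≤ lowerIntegral J f) : |integral J f - b| ≤ r := by
  have hr := EReal.coe_toReal hf.2.2.ne (hf.2.1 ▸ hf.1).ne'
  rw [hf.2.1] at h2
  rw [← hr, EReal.coe_le_coe_iff] at h1 h2
  rw [integral, abs_le]
  constructor <;> linarith

end Daniell

/-! ### Harmonic functions in the plane -/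

namespace InnerProductSpace

open Metric Complex

section Isometry

variable {E F : Type*} [NormedAddCommGroup E] [InnerProductSpace ℝ E] [FiniteDimensional ℝ E]
  [NormedAddCommGroup F] [InnerProductSpace ℝ F] [FiniteDimensional ℝ F]

theorem laplacian_comp_linearIsometryEquiv (e : E ≃ₗᵢ[ℝ] F) (f : F → ℝ) :
    Laplacian.laplacian (f ∘ e) = Laplacian.laplacian f ∘ e := by
  ext x
  have key := e.toContinuousLinearEquiv.iteratedFDerivWithin_comp_right f uniqueDiffOn_univ
    (Set.mem_univ (e x)) 2
  rw [Set.preimage_univ, iteratedFDerivWithin_univ, iteratedFDerivWithin_univ] at key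
  rw [laplacian_eq_iteratedFDeriv_orthonormalBasis _ (stdOrthonormalBasis ℝ E),
    laplacian_eq_iteratedFDeriv_orthonormalBasis _ ((stdOrthonormalBasis ℝ E).map e)]
  refine Finset.sum_congr rfl fun i _ => ?_
  refine (congrArg (fun L => L ![stdOrthonormalBasis ℝ E i, stdOrthonormalBasis ℝ E i]) key).trans ?_
  simp only [ContinuousMultilinearMap.compContinuousLinearMap_apply, OrthonormalBasis.map_apply]
  congr 1
  ext j
  fin_cases j <;> rfl

theorem HarmonicAt.comp_linearIsometryEquiv (e : E ≃ₗᵢ[ℝ] F) {f : F → ℝ} {x : E}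
    (h : HarmonicAt f (e x)) : HarmonicAt (f ∘ e) x := by
  refine ⟨h.1.comp x e.contDiff.contDiffAt, ?_⟩
  rw [laplacian_comp_linearIsometryEquiv]
  exact e.continuous.continuousAt.eventually h.2

theorem HarmonicAt.comp_add_const {f : E → ℝ} {x a : E} (h : HarmonicAt f (x + a)) :
    HarmonicAt (fun y => f (y + a)) x := by
  have hlap : Laplacian.laplacian (fun y => f (y + a)) = fun y => Laplacian.laplacian f (y + a) := by
    ext y
    simp only [laplacian_eq_iteratedFDeriv_stdOrthonormalBasis, iteratedFDeriv_comp_add_right]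
  refine ⟨h.1.comp x (contDiff_id.add contDiff_const).contDiffAt, ?_⟩
  rw [hlap]
  exact (continuous_add_const a).continuousAt.eventually h.2

end Isometry

/-- **Harnack's inequality** on a disk in the complex plane, with the constant for the
concentric disk of half the radius. -/
theorem HarmonicOnNhd.harnack_complex {u : ℂ → ℝ} {c w : ℂ} {R : ℝ} (hR : 0 < R)
    (hu : HarmonicOnNhd u (closedBall c R)) (h0 : ∀ z ∈ closedBall c R, 0 ≤ u z)
    (hw : w ∈ closedBall c (R / 2)) : u w ≤ 3 * u c ∧ u c ≤ 3 * u w := by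
  have hwR : w ∈ ball c R := closedBall_subset_ball (by linarith) hw
  have hn : ‖w - c‖ ≤ R / 2 := mem_closedBall_iff_norm.1 hw
  have habs : |R| = R := abs_of_pos hR
  have hmean : Real.circleAverage u c R = u c := by
    apply HarmonicOnNhd.circleAverage_eq; rwa [habs]
  have hpois := hu.circleAverage_re_herglotzRieszKernel_smul hwR
  have hcu : ContinuousOn u (sphere c R) := hu.continuousOn.mono sphere_subset_closedBall
  have hint : CircleIntegrable u c R := hcu.circleIntegrable hR.le
  have hintP : CircleIntegrable ((re ∘ herglotzRieszKernel c w) • u) c R := by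
    refine ContinuousOn.circleIntegrable hR.le ?_
    have := continuousOn_herglotzRieszKernel_sphere hwR
    rw [habs] at this
    exact (continuous_re.comp_continuousOn this).smul hcu
  constructor
  · rw [← hpois, ← hmean, ← smul_eq_mul, ← Real.circleAverage_smul]
    refine Real.circleAverage_mono hintP (hint.const_smul) fun z hz => ?_
    rw [habs] at hz
    have h1 := re_herglotzRieszKernel_le hz hwR
    have h2 : (R + ‖w - c‖) / (R - ‖w - c‖) ≤ 3 := by
      rw [div_le_iff₀ (by linarith)]; linarith
    exact mul_le_mul_of_nonneg_right (h1.trans h2) (h0 z (sphere_subset_closedBall hz))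
  · rw [← hpois, ← hmean, ← smul_eq_mul, ← Real.circleAverage_smul]
    refine Real.circleAverage_mono hint (hintP.const_smul) fun z hz => ?_
    rw [habs] at hz
    have h1 := le_re_herglotzRieszKernel hz hwR
    have h2 : 1 / 3 ≤ (R - ‖w - c‖) / (R + ‖w - c‖) := by
      rw [div_le_div_iff₀ (by norm_num) (by positivity)]; linarith
    have h3 := mul_le_mul_of_nonneg_right (h2.trans h1) (h0 z (sphere_subset_closedBall hz))
    change u z ≤ 3 * (((z - c + (w - c)) / (z - c - (w - c))).re * u z)
    linarith

/-- A uniform limit of harmonic functions on a disk is harmonic at the centre: it inherits the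
Poisson formula, which presents it as the real part of the Herglotz integral of its boundary
values, a holomorphic function. -/
theorem harmonicAt_of_uniform_approx_complex {v : ℂ → ℝ} {R : ℝ} (hR : 0 < R)
    (h : ∀ ε > 0, ∃ u : ℂ → ℝ, HarmonicOnNhd u (closedBall 0 R) ∧
      ∀ z ∈ closedBall 0 R, |v z - u z| ≤ ε) : HarmonicAt v 0 := by
  have habs : |R| = R := abs_of_pos hR
  choose u hu hvu using fun n : ℕ => h (1 / ((n : ℝ) + 1)) (by positivity)
  have hunif : TendstoUniformlyOn u v atTop (closedBall 0 R) := by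
    rw [Metric.tendstoUniformlyOn_iff]
    intro ε hε
    obtain ⟨N, hN⟩ := exists_nat_one_div_lt hε
    filter_upwards [eventually_ge_atTop N] with n hn z hz
    refine (hvu n z hz).trans_lt (lt_of_le_of_lt ?_ hN)
    exact one_div_le_one_div_of_le (by positivity) (by exact_mod_cast Nat.succ_le_succ hn)
  have hvc : ContinuousOn v (closedBall 0 R) :=
    hunif.continuousOn (Eventually.of_forall fun n => (hu n).continuousOn).frequently
  have hcv : ContinuousOn v (sphere 0 R) := hvc.mono sphere_subset_closedBall
  have hint : CircleIntegrable v 0 R := hcv.circleIntegrable hR.le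
  have hpois : ∀ w ∈ ball (0 : ℂ) R,
      Real.circleAverage ((re ∘ herglotzRieszKernel 0 w) • v) 0 R = v w := by
    intro w hw
    have hk := continuousOn_herglotzRieszKernel_sphere hw
    rw [habs] at hk
    have hkr := continuous_re.comp_continuousOn hk
    have hw' := ball_subset_closedBall hw
    set K := (R + ‖w - 0‖) / (R - ‖w - 0‖) with hK
    have hwn : ‖w - 0‖ < R := mem_ball_iff_norm.1 hw
    have hK0 : 0 ≤ K := div_nonneg (by positivity) (by linarith)
    have hiv : CircleIntegrable ((re ∘ herglotzRieszKernel 0 w) • v) 0 R :=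
      ContinuousOn.circleIntegrable hR.le (hkr.smul hcv)
    have hest : ∀ n : ℕ, |Real.circleAverage ((re ∘ herglotzRieszKernel 0 w) • v) 0 R - v w|
        ≤ (K + 1) * (1 / ((n : ℝ) + 1)) := by
      intro n
      have hiu : CircleIntegrable ((re ∘ herglotzRieszKernel 0 w) • u n) 0 R :=
        ContinuousOn.circleIntegrable hR.le
          (hkr.smul ((hu n).continuousOn.mono sphere_subset_closedBall))
      have h1 : |Real.circleAverage ((re ∘ herglotzRieszKernel 0 w) • v) 0 R - u n w|
          ≤ K * (1 / ((n : ℝ) + 1)) := by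
        rw [← (hu n).circleAverage_re_herglotzRieszKernel_smul hw,
          ← Real.circleAverage_sub hiv hiu]
        refine Real.abs_circleAverage_le_circleAverage_abs.trans ?_
        refine Real.circleAverage_mono_on_of_le_circle (hiv.sub hiu).abs fun z hz => ?_
        rw [habs] at hz
        have hz' := sphere_subset_closedBall hz
        have e1 := re_herglotzRieszKernel_le hz hw
        have e2 := le_re_herglotzRieszKernel hz hw
        have e3 : 0 ≤ (R - ‖w - 0‖) / (R + ‖w - 0‖) := div_nonneg (by linarith) (by positivity)
        have e4 : |re (herglotzRieszKernel 0 w z)| ≤ K := by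
          rw [herglotzRieszKernel_def, abs_of_nonneg (e3.trans e2)]
          exact e1
        change |re (herglotzRieszKernel 0 w z) * v z - re (herglotzRieszKernel 0 w z) * u n z| ≤ _
        rw [← mul_sub, abs_mul]
        exact mul_le_mul e4 (hvu n z hz') (abs_nonneg _) hK0
      have h2 := hvu n w hw'
      rw [abs_sub_comm] at h2
      have := abs_sub_le (Real.circleAverage ((re ∘ herglotzRieszKernel 0 w) • v) 0 R) (u n w) (v w)
      linarith
    have hlim : Tendsto (fun n : ℕ => (K + 1) * (1 / ((n : ℝ) + 1))) atTop (𝓝 0) := by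
      simpa using tendsto_one_div_add_atTop_nhds_zero_nat.const_mul (K + 1)
    have := ge_of_tendsto' hlim hest
    exact sub_eq_zero.1 (abs_nonpos_iff.1 this)
  have hcint : CircleIntegrable (fun z => (v z : ℂ)) 0 R :=
    (continuous_ofReal.comp_continuousOn hcv).circleIntegrable hR.le
  have han := analyticOnNhd_circleAverage_herglotzRieszKernel_smul hcint 0 (mem_ball_self hR)
  refine (harmonicAt_congr_nhds ?_).1 han.harmonicAt_re
  filter_upwards [ball_mem_nhds 0 hR] with w hw
  rw [re_circleAverage_herglotzRieszKernel_smul hint hw, hpois w hw]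

/-- Harnack's inequality on a disk of the Euclidean plane. -/
theorem HarmonicOnNhd.harnack {u : EuclideanSpace ℝ (Fin 2) → ℝ}
    {c w : EuclideanSpace ℝ (Fin 2)} {R : ℝ} (hR : 0 < R)
    (hu : HarmonicOnNhd u (closedBall c R)) (h0 : ∀ z ∈ closedBall c R, 0 ≤ u z)
    (hw : w ∈ closedBall c (R / 2)) : u w ≤ 3 * u c ∧ u c ≤ 3 * u w := by
  set e := Complex.orthonormalBasisOneI.repr
  have hmem : ∀ z ∈ closedBall (e.symm c) R, e z ∈ closedBall c R := fun z hz => by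
    rw [mem_closedBall] at hz ⊢
    rwa [← e.apply_symm_apply c, e.dist_map]
  have := HarmonicOnNhd.harnack_complex (u := u ∘ e) (c := e.symm c) (w := e.symm w) hR
    (fun z hz => (hu _ (hmem z hz)).comp_linearIsometryEquiv e) (fun z hz => h0 _ (hmem z hz))
    (by rw [mem_closedBall] at hw ⊢; rwa [e.symm.dist_map])
  simpa using this

/-- A uniform limit of harmonic functions on a disk of the Euclidean plane is harmonic at the
centre. -/
theorem harmonicAt_of_uniform_approx {v : EuclideanSpace ℝ (Fin 2) → ℝ}
    {c : EuclideanSpace ℝ (Fin 2)} {R : ℝ} (hR : 0 < R)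
    (h : ∀ ε > 0, ∃ u : EuclideanSpace ℝ (Fin 2) → ℝ, HarmonicOnNhd u (closedBall c R) ∧
      ∀ z ∈ closedBall c R, |v z - u z| ≤ ε) : HarmonicAt v c := by
  set e := Complex.orthonormalBasisOneI.repr
  -- The isometry `z ↦ e z + c` of the complex plane onto the Euclidean plane maps `0` to `c`.
  have hmem : ∀ z ∈ closedBall (0 : ℂ) R, e z + c ∈ closedBall c R := fun z hz => by
    rw [mem_closedBall_zero_iff] at hz
    rwa [mem_closedBall_iff_norm, add_sub_cancel_right, e.norm_map]
  have h0 : HarmonicAt (fun z => v (e z + c)) 0 := by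
    refine harmonicAt_of_uniform_approx_complex hR fun ε hε => ?_
    obtain ⟨u, hu, hvu⟩ := h ε hε
    refine ⟨fun z => u (e z + c), fun z hz => ?_, fun z hz => hvu _ (hmem z hz)⟩
    exact HarmonicAt.comp_linearIsometryEquiv (f := fun p => u (p + c)) e
      (hu _ (hmem z hz)).comp_add_const
  have h1 : HarmonicAt (fun p => v (p + c)) 0 := by
    have := HarmonicAt.comp_linearIsometryEquiv (x := 0) e.symm
      (f := fun z => v (e z + c)) (by simpa using h0)
    simpa [Function.comp_def] using this
  have h2 := HarmonicAt.comp_add_const (f := fun p => v (p + c)) (x := c) (a := -c)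
    (by simpa using h1)
  simpa using h2

/-- The **Harnack principle** with a locally bounded constant: on a connected open set, the
nonnegative harmonic functions are dominated near `y` by a fixed multiple of their value
at `x`. -/
theorem exists_harnack_const {D : Set (EuclideanSpace ℝ (Fin 2))} (hopen : IsOpen D)
    (hconn : IsPreconnected D) {x y : EuclideanSpace ℝ (Fin 2)} (hx : x ∈ D) (hy : y ∈ D) :
    ∃ C : ℝ, ∀ᶠ z in 𝓝 y, ∀ u : EuclideanSpace ℝ (Fin 2) → ℝ, HarmonicOnNhd u D →
      (∀ p ∈ D, 0 ≤ u p) → u z ≤ C * u x := by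
  set S := {y | ∃ C : ℝ, ∀ᶠ z in 𝓝 y, ∀ u : EuclideanSpace ℝ (Fin 2) → ℝ, HarmonicOnNhd u D →
      (∀ p ∈ D, 0 ≤ u p) → u z ≤ C * u x} with hS
  have hSo : IsOpen S := by
    rw [isOpen_iff_mem_nhds]
    rintro y ⟨C, hC⟩
    filter_upwards [hC.eventually_nhds] with z hz using ⟨C, hz⟩
  -- Every point of `D` is the centre of a disk of radius `r` on which any value of a nonnegative
  -- harmonic function bounds any other up to the factor `9`.
  have hdisk : ∀ y ∈ D, ∃ r > 0, ∀ z ∈ closedBall y r, ∀ w ∈ closedBall y r,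
      ∀ u : EuclideanSpace ℝ (Fin 2) → ℝ, HarmonicOnNhd u D →
      (∀ p ∈ D, 0 ≤ u p) → u w ≤ 9 * u z := by
    intro y hy
    obtain ⟨R, hR, hRD⟩ := nhds_basis_closedBall.mem_iff.1 (hopen.mem_nhds hy)
    refine ⟨R / 2, half_pos hR, fun z hz w hw u hu h0 => ?_⟩
    have h1 := (hu.mono hRD).harnack hR (fun p hp => h0 p (hRD hp)) hz
    have h2 := (hu.mono hRD).harnack hR (fun p hp => h0 p (hRD hp)) hw
    linarith [h1.2, h2.1]
  have hxS : x ∈ S := by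
    obtain ⟨r, hr, hrD⟩ := hdisk x hx
    refine ⟨9, ?_⟩
    filter_upwards [closedBall_mem_nhds x hr] with z hz
    exact hrD x (mem_closedBall_self hr.le) z hz
  refine hconn.subset_of_closure_inter_subset hSo ⟨x, hx, hxS⟩ ?_ hy
  rintro y ⟨hyS, hyD⟩
  obtain ⟨r, hr, hrD⟩ := hdisk y hyD
  obtain ⟨z, hzr, C, hC⟩ := mem_closure_iff_nhds.1 hyS _ (closedBall_mem_nhds y hr)
  refine ⟨9 * C, ?_⟩
  filter_upwards [closedBall_mem_nhds y hr] with w hw u hu h0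
  have h1 := hrD z hzr w hw u hu h0
  have h2 := hC.self_of_nhds u hu h0
  linarith

/-- The minimum principle on a bounded domain. At an interior minimum Harnack's inequality,
applied to the difference of the function and its minimum, forces the function to be constant. -/
theorem nonneg_of_frontier_nonneg {D : Set (EuclideanSpace ℝ (Fin 2))} (hopen : IsOpen D)
    (hconn : IsConnected D) (hbdd : Bornology.IsBounded D)
    {u : EuclideanSpace ℝ (Fin 2) → ℝ} (hu : HarmonicContOnCl u D)
    (h0 : ∀ z ∈ frontier D, 0 ≤ u z) : ∀ z ∈ D, 0 ≤ u z := by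
  have hfr : (frontier D).Nonempty := by
    rw [nonempty_frontier_iff]
    refine ⟨hconn.nonempty, ?_⟩
    rintro rfl
    exact NormedSpace.unbounded_univ ℝ _ hbdd
  obtain ⟨q, hq⟩ := hfr
  obtain ⟨p, hp, hmin⟩ := hbdd.isCompact_closure.exists_isMinOn
    (hconn.nonempty.mono subset_closure) hu.continuousOn
  have hmin' : ∀ z ∈ closure D, u p ≤ u z := hmin
  suffices h : 0 ≤ u p from fun z hz => h.trans (hmin' z (subset_closure hz))
  by_contra! hneg
  have hpD : p ∈ D := by
    by_contra hpD
    exact hneg.not_ge (h0 p (by rw [hopen.frontier_eq]; exact ⟨hp, hpD⟩))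
  have hconst : ∀ z ∈ D, u z ≤ u p := by
    intro z hz
    obtain ⟨C, hC⟩ := exists_harnack_const hopen hconn.isPreconnected hpD hz
    have := hC.self_of_nhds (fun y => u y - u p)
      (hu.harmonicOnNhd.sub (harmonicOnNhd_const (u p)))
      (fun y hy => sub_nonneg.2 (hmin' y (subset_closure hy)))
    simpa using this
  have hle : u q ≤ u p := by
    have hcl := frontier_subset_closure hq
    have hlim : Tendsto u (𝓝[D] q) (𝓝 (u q)) := (hu.continuousOn q hcl).mono subset_closure
    have hne := mem_closure_iff_nhdsWithin_neBot.1 hcl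
    exact le_of_tendsto hlim (eventually_mem_nhdsWithin.mono hconst)
  linarith [h0 q hq]

end InnerProductSpace

/-! ### The Dirichlet functionals -/

namespace Dirichlet

open InnerProductSpace

variable {D : Set (EuclideanSpace ℝ (Fin 2))}

theorem IsSolution.eqOn (hopen : IsOpen D) (hconn : IsConnected D) (hbdd : Bornology.IsBounded D)
    {g : C(frontier D, ℝ)} {u v : EuclideanSpace ℝ (Fin 2) → ℝ} (hu : IsSolution D g u)
    (hv : IsSolution D g v) : Set.EqOn u v D := by
  have key : ∀ {u v : EuclideanSpace ℝ (Fin 2) → ℝ}, IsSolution D g u → IsSolution D g v →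
      ∀ z ∈ D, v z ≤ u z := fun {u v} hu hv z hz => by
    have := nonneg_of_frontier_nonneg hopen hconn hbdd (u := u - v)
      ⟨hu.harmonic.sub hv.harmonic, hu.continuousOn.sub hv.continuousOn⟩
      (fun p hp => by
        have h1 := hu.boundary ⟨p, hp⟩
        have h2 := hv.boundary ⟨p, hp⟩
        simp only [Pi.sub_apply]
        linarith) z hz
    simpa using this
  exact fun z hz => le_antisymm (key hv hu z hz) (key hu hv z hz)

theorem isSolution_solution (hD : Solvable D) (g : C(frontier D, ℝ)) :
    IsSolution D g (solution hD g) :=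
  Classical.choose_spec (hD g)

theorem isPositiveLinear_functional (hopen : IsOpen D) (hconn : IsConnected D)
    (hbdd : Bornology.IsBounded D) (hD : Solvable D) {x : EuclideanSpace ℝ (Fin 2)} (hx : x ∈ D) :
    Daniell.IsPositiveLinear (functional hD x) where
  map_add g h := by
    have hg := isSolution_solution hD g
    have hh := isSolution_solution hD h
    refine (isSolution_solution hD (g + h)).eqOn hopen hconn hbdd
      (v := solution hD g + solution hD h) ⟨hg.harmonic.add hh.harmonic,
        hg.continuousOn.add hh.continuousOn, fun z => ?_⟩ hx
    simp [hg.boundary z, hh.boundary z]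
  map_smul c g := by
    have hg := isSolution_solution hD g
    refine (isSolution_solution hD (c • g)).eqOn hopen hconn hbdd
      (v := c • solution hD g) ⟨hg.harmonic.const_smul, hg.continuousOn.const_smul c,
        fun z => ?_⟩ hx
    simp [hg.boundary z]
  nonneg g hg := by
    have hs := isSolution_solution hD g
    exact nonneg_of_frontier_nonneg hopen hconn hbdd ⟨hs.harmonic, hs.continuousOn⟩
      (fun z hz => by rw [hs.boundary ⟨z, hz⟩]; exact hg _) x hx

/-- The functionals at points near `y` are dominated by a fixed multiple of the functional
at `x`. -/
theorem exists_functional_le (hopen : IsOpen D) (hconn : IsConnected D)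
    (hbdd : Bornology.IsBounded D) (hD : Solvable D) {x y : EuclideanSpace ℝ (Fin 2)}
    (hx : x ∈ D) (hy : y ∈ D) :
    ∃ C : ℝ, 0 ≤ C ∧ ∀ᶠ z in 𝓝 y, ∀ g : C(frontier D, ℝ), 0 ≤ g →
      functional hD z g ≤ C * functional hD x g := by
  obtain ⟨C, hC⟩ := exists_harnack_const hopen hconn.isPreconnected hx hy
  refine ⟨C, ?_, hC.mono fun z hz g hg => hz _ (isSolution_solution hD g).harmonic
    fun p hp => (isPositiveLinear_functional hopen hconn hbdd hD hp).nonneg g hg⟩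
  have := hC.self_of_nhds (fun _ => 1) (harmonicOnNhd_const 1) fun _ _ => zero_le_one
  linarith

end Dirichlet

theorem mainTheorem12 (D : Set (EuclideanSpace ℝ (Fin 2)))
    (hopen : IsOpen D) (hconn : IsConnected D) (hbdd : Bornology.IsBounded D)
    (hsolv : Dirichlet.Solvable D)
    (x : EuclideanSpace ℝ (Fin 2)) (hx : x ∈ D) (f : frontier D → EReal)
    (hf : Daniell.Integrable (Dirichlet.functional hsolv x) f) :
    (∀ y ∈ D, Daniell.Integrable (Dirichlet.functional hsolv y) f) ∧
      InnerProductSpace.HarmonicOnNhd (Dirichlet.generalizedSolution hsolv f) D := by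
  have : CompactSpace (frontier D) :=
    isCompact_iff_compactSpace.1 (hbdd.isCompact_closure.of_isClosed_subset isClosed_frontier
      frontier_subset_closure)
  have hpos : ∀ {z}, z ∈ D → Daniell.IsPositiveLinear (Dirichlet.functional hsolv z) :=
    Dirichlet.isPositiveLinear_functional hopen hconn hbdd hsolv
  have hint : ∀ y ∈ D, Daniell.Integrable (Dirichlet.functional hsolv y) f := by
    intro y hy
    obtain ⟨C, hC0, hC⟩ := Dirichlet.exists_functional_le hopen hconn hbdd hsolv hx hy
    refine Daniell.Integrable.of_forall_approx (hpos hy) hC0 fun ε hε => ?_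
    obtain ⟨g, hg⟩ := hf.exists_continuous_approx (hpos hx) hε
    exact ⟨_, hg _ C (hpos hy) hC0 hC.self_of_nhds⟩
  refine ⟨hint, fun y hy => ?_⟩
  obtain ⟨C, hC0, hC⟩ := Dirichlet.exists_functional_le hopen hconn hbdd hsolv hx hy
  obtain ⟨R, hR, hRD⟩ :=
    Metric.nhds_basis_closedBall.mem_iff.1 (hC.and (hopen.mem_nhds hy))
  refine InnerProductSpace.harmonicAt_of_uniform_approx hR fun ε hε => ?_
  obtain ⟨g, hg⟩ := hf.exists_continuous_approx (hpos hx) (ε := ε / (C + 1)) (by positivity)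
  refine ⟨Dirichlet.solution hsolv g, fun z hz =>
    (Dirichlet.isSolution_solution hsolv g).harmonic z (hRD hz).2, fun z hz => ?_⟩
  obtain ⟨hzC, hzD⟩ := hRD hz
  obtain ⟨h1, h2⟩ := hg _ C (hpos hzD) hC0 hzC
  refine ((hint z hzD).abs_integral_sub_le h1 h2).trans ?_
  rw [mul_div_assoc', div_le_iff₀ (by positivity)]
  nlinarith
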